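/- Work in the deterministic cut-query model: the finite vertex set $V$, $|V|=n$, is known, the edges of a simple undirected unweighted graph $G$ on $V$ are hidden, and the algorithm may adaptively query sets $S\subseteq V$, receiving each time $|\partial_G(S)|$, the number of edges of $G$ with exactly one endpoint in $S$. For $R\subseteq V$ and $r\in R$, an isolating cut of $r$ is a cut $(C,V\setminus C)$ with $r\in C$ and $C\cap (R\setminus\{r\})=\emptyset$; its size is $|\partial_G(C)|$. A minimum isolating cut of $r$ is one of minimum size, and a minimum isolating cut of $R$ is a cut of smallest size among the minimum isolating cuts of all $r\in R$. There is a deterministic cut-query algorithm which takes as input $V$, a terminal set $R\subseteq V$ and an integer $\tau\ge 0$, with the following property. For every $a\in\mathbb R$ and $k\in\mathbb N$ there are $b\in\mathbb R$ and $l\in\mathbb N$ such that, for all $V$ with $|V|=n$, all $R\subseteq V$ and all integers $\tau\ge0$ with $|R|\,\tau\le a\,(1+\log n)^k\,n$ (that is, $|R|=\widetilde O(n/\tau)$; no restriction on $R$ if $\tau=0$ and $a \ge 0$), and for every simple graph $G$ on $V$, the algorithm makes at most $b\,(1+\log n)^{l}\,n^{5/3}$ cut queries (that is, $\widetilde O(n^{5/3})$)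 and either - outputs a minimum isolating cut of $R$, of size at most $\tau$, or - certifies (by reporting so, always correctly) that every isolating cut of every $r\in R$ has size greater than $\tau$. (Here $\log 0$ is read as $0$ when $n=0$.) -/

import Mathlib

universe u

/-- `|∂_G(S)|`: the number of edges of the simple graph `G` with exactly one endpoint in `S`, counted
as the pairs `(a, b)` with `a ∈ S`, `b ∉ S` and `a` adjacent to `b`. This is also the answer
`Cut(S)` of the cut-query oracle. -/
noncomputable def cutSize {V : Type u} [Fintype V] (G : SimpleGraph V) (S : Finset V) : ℕ :=
  open Classical in (G.interedges S Sᶜ).card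

/-- The cut `(C, V \ C)` separates `A` from `B`, with `A` on the side of `C`. -/
def IsSeparatingCut {V : Type u} (A B : Set V) (C : Finset V) : Prop :=
  A ⊆ (C : Set V) ∧ Disjoint B (C : Set V)

/-- The cut `(C, V \ C)` is an `A`-`B` min-cut of `G`. -/
def IsMinSeparatingCut {V : Type u} [Fintype V] (G : SimpleGraph V) (A B : Set V)
    (C : Finset V) : Prop :=
  IsSeparatingCut A B C ∧
    ∀ C' : Finset V, IsSeparatingCut A B C' → cutSize G C ≤ cutSize G C'

/-- The cut `(C, V \ C)` isolates the terminal `r` from all other terminals of `R`. -/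
def IsIsolatingCut {V : Type u} (R : Finset V) (r : V) (C : Finset V) : Prop :=
  IsSeparatingCut {r} ((R : Set V) \ {r}) C

/-- The cut `(C, V \ C)` is a minimum isolating cut of `r` with respect to `R`:
an `{r}`-`(R \ {r})` min-cut. -/
def IsMinIsolatingCutOf {V : Type u} [Fintype V] (G : SimpleGraph V) (R : Finset V) (r : V)
    (C : Finset V) : Prop :=
  IsMinSeparatingCut G {r} ((R : Set V) \ {r}) C

/-- The cut `(C, V \ C)` is a minimum isolating cut of `R`: a smallest one among the
minimum isolating cuts of all `r ∈ R`. -/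
def IsMinIsolatingCut {V : Type u} [Fintype V] (G : SimpleGraph V) (R : Finset V)
    (C : Finset V) : Prop :=
  (∃ r ∈ R, IsMinIsolatingCutOf G R r C) ∧
    ∀ r' ∈ R, ∀ C' : Finset V, IsMinIsolatingCutOf G R r' C' → cutSize G C ≤ cutSize G C'

/-- A deterministic adaptive algorithm in the cut-query model on the (known) vertex set `V`, as a
decision tree: it either stops with an output, or queries a vertex set `S` and continues depending
on the number it is told. The tree does not see the edges of the graph in any other way. -/
inductive CutQueryAlg (V : Type u) (Out : Type u) : Type u where
  | output : Out → CutQueryAlg V Out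
  | query : Finset V → (ℕ → CutQueryAlg V Out) → CutQueryAlg V Out

namespace CutQueryAlg

/-- The output of the algorithm when the hidden graph is `G`. -/
noncomputable def run {V Out : Type u} [Fintype V] (G : SimpleGraph V) : CutQueryAlg V Out → Out
  | output o => o
  | query S next => run G (next (cutSize G S))

/-- The number of cut queries that the algorithm makes when the hidden graph is `G`. -/
noncomputable def queries {V Out : Type u} [Fintype V] (G : SimpleGraph V) :
    CutQueryAlg V Out → ℕ
  | output _ => 0
  | query S next => queries G (next (cutSize G S)) + 1

end CutQueryAlg

/-- The answer `ans` is right for `(G, R, τ)`: `some C` presents a minimum isolating cut `(C, V \ C)`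
of `R` of size at most `τ`, and `none` certifies that every isolating cut has size
larger than `τ`. -/
def IsIsolatingCutAnswer {V : Type u} [Fintype V] (G : SimpleGraph V) (R : Finset V) (τ : ℕ)
    (ans : Option (Finset V)) : Prop :=
  match ans with
  | some C => IsMinIsolatingCut G R C ∧ cutSize G C ≤ τ
  | none => ∀ r ∈ R, ∀ C : Finset V, IsIsolatingCut R r C → τ < cutSize G C

namespace CutQuery

open Classical

variable {V : Type u}

/-! The algorithm has two layers.

A single minimum cut costs about `D * (vertices + source capacity)` edge searches with `D` near `n ^
(2/3)`. An edge search is a binary search costing `O(log n)` queries, since three cut queries give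
the number of edges between disjoint sets. Push-relabel with labels up to `D` needs only one new
edge per step. When it stops, some two consecutive levels have total size at most `2 * n / D`. The
cut between them exceeds the delivered flow by at most twice the product of their sizes, hence by at
most `2 * D` because `n ^ 2 ≤ D ^ 3` (`exists_networkCut_le`). The minimum cut is then known up to
`2 * D`, and the gap is closed by learning edges across the least minimum cut of the known subgraph
(`Solves.learnMinCut`): each new edge raises the minimum or enlarges the least minimizer.

Isolating cuts reduce to few such cuts. For each binary digit of a vertex numbering, one cut
separates the terminals by that digit. Submodularity lets an isolating cut of size at most `τ` be
trimmed to the sides containing its terminal (`exists_subset_region`). Distinct terminals differ in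
a digit, so the resulting regions are disjoint, and one minimum cut per region costs in total about
as much as one on the whole graph. Terminal capacities are `τ + 1` rather than infinite, so that the
total source capacity is `O(n + |R| * τ)`.

Knowledge about the hidden graph is the predicate `P` in `Solves`; every algorithmic step
strengthens `P` and adds to the budget. -/

/-- `Solves P Q c`: some decision tree answers correctly, in the sense of `Q`, on every graph that
satisfies `P`, with at most `c` queries. -/
def Solves [Fintype V] {Out : Type u} (P : SimpleGraph V → Prop) (Q : SimpleGraph V → Out → Prop)
    (c : ℕ) : Prop :=
  ∃ alg : CutQueryAlg V Out, ∀ G, P G → Q G (alg.run G) ∧ alg.queries G ≤ c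

/-! ### Counting edges between vertex sets -/

/-- The number of ordered pairs in `X × Y` that are adjacent in `G`. -/
noncomputable def edgesBetween (G : SimpleGraph V) (X Y : Finset V) : ℤ :=
  ∑ u ∈ X, ∑ v ∈ Y, if G.Adj u v then 1 else 0

section EdgeCount

variable (G : SimpleGraph V)

lemma edgesBetween_comm (X Y : Finset V) : edgesBetween G X Y = edgesBetween G Y X := by
  unfold edgesBetween
  rw [Finset.sum_comm]
  simp only [G.adj_comm]

lemma edgesBetween_nonneg (X Y : Finset V) : 0 ≤ edgesBetween G X Y :=
  Finset.sum_nonneg fun _ _ => Finset.sum_nonneg fun _ _ => by split_ifs <;> norm_num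

lemma edgesBetween_union_left {X X' : Finset V} (h : Disjoint X X') (Y : Finset V) :
    edgesBetween G (X ∪ X') Y = edgesBetween G X Y + edgesBetween G X' Y :=
  Finset.sum_union h

lemma edgesBetween_union_right (X : Finset V) {Y Y' : Finset V} (h : Disjoint Y Y') :
    edgesBetween G X (Y ∪ Y') = edgesBetween G X Y + edgesBetween G X Y' := by
  rw [edgesBetween_comm, edgesBetween_union_left G h, edgesBetween_comm G Y, edgesBetween_comm G Y']

lemma edgesBetween_mono {G H : SimpleGraph V} (h : H ≤ G) (X Y : Finset V) :
    edgesBetween H X Y ≤ edgesBetween G X Y := by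
  refine Finset.sum_le_sum fun u _ => Finset.sum_le_sum fun v _ => ?_
  by_cases h1 : H.Adj u v
  · simp [h1, h h1]
  · simp only [h1, if_false]; split_ifs <;> norm_num

lemma edgesBetween_eq_sum_left (X Y : Finset V) :
    edgesBetween G X Y = ∑ v ∈ X, edgesBetween G {v} Y := by
  simp [edgesBetween]

lemma cutSize_eq_edgesBetween [Fintype V] (S : Finset V) :
    (cutSize G S : ℤ) = edgesBetween G S Sᶜ := by
  unfold cutSize edgesBetween SimpleGraph.interedges Rel.interedges
  rw [Finset.card_filter, Finset.sum_product]
  push_cast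
  congr! 3

/-- An edge between `X` and `Y` is cut by both sets but not by their union; every other edge
contributes equally to both sides. This turns three cut queries into an edge count. -/
lemma two_mul_edgesBetween [Fintype V] {X Y : Finset V} (h : Disjoint X Y) :
    2 * edgesBetween G X Y = (cutSize G X : ℤ) + cutSize G Y - cutSize G (X ∪ Y) := by
  have hd : ∀ v, v ∈ X → v ∉ Y := fun v h1 h2 => (Finset.disjoint_left.mp h) h1 h2
  have e1 : Xᶜ = Y ∪ (X ∪ Y)ᶜ := by ext v; have := hd v; simp; tauto
  have e2 : Yᶜ = X ∪ (X ∪ Y)ᶜ := by ext v; have := hd v; simp; tauto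
  have d1 : Disjoint Y (X ∪ Y)ᶜ := by
    rw [Finset.disjoint_left]; intro v; simp; tauto
  have d2 : Disjoint X (X ∪ Y)ᶜ := by
    rw [Finset.disjoint_left]; intro v; simp; tauto
  simp only [cutSize_eq_edgesBetween]
  rw [e1, e2, edgesBetween_union_right G _ d1, edgesBetween_union_right G _ d2,
    edgesBetween_union_left G h, edgesBetween_comm G Y X]
  ring

/-- Already known edges are subtracted from the count, so a comparison of numbers detects whether an
unknown edge exists. -/
lemma edgesBetween_eq_iff {X Y : Finset V} {kn : V → V → Prop}
    (h : ∀ u ∈ X, ∀ v ∈ Y, kn u v → G.Adj u v) :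
    edgesBetween G X Y = (∑ u ∈ X, ∑ v ∈ Y, if kn u v then 1 else 0) ↔
      ∀ u ∈ X, ∀ v ∈ Y, G.Adj u v → kn u v := by
  unfold edgesBetween
  simp only [← Finset.sum_product']
  rw [eq_comm, Finset.sum_eq_sum_iff_of_le]
  · constructor
    · intro H u hu v hv hA
      have := H (u, v) (by simp [hu, hv])
      by_contra hk
      simp [hA, hk] at this
    · rintro H ⟨u, v⟩ hp
      simp only [Finset.mem_product] at hp
      have h1 := h u hp.1 v hp.2
      have h2 := H u hp.1 v hp.2
      by_cases hk : kn u v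
      · simp [hk, h1 hk]
      · have : ¬ G.Adj u v := fun hA => hk (h2 hA)
        simp [hk, this]
  · rintro ⟨u, v⟩ hp
    simp only [Finset.mem_product] at hp
    have h1 := h u hp.1 v hp.2
    by_cases hk : kn u v
    · simp [hk, h1 hk]
    · simp only [hk, if_false]; split_ifs <;> norm_num

lemma exists_split (X : Finset V) {a : ℕ} (h : X.card ≤ 2 ^ (a + 1)) :
    ∃ X₁ X₂ : Finset V, Disjoint X₁ X₂ ∧ X₁ ∪ X₂ = X ∧ X₁.card ≤ 2 ^ a ∧ X₂.card ≤ 2 ^ a := by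
  obtain ⟨X₁, h1, h2⟩ := Finset.exists_subset_card_eq (Nat.div_le_self X.card 2)
  refine ⟨X₁, X \ X₁, Finset.disjoint_sdiff, Finset.union_sdiff_of_subset h1, ?_, ?_⟩
  · rw [pow_succ] at h; omega
  · rw [Finset.card_sdiff_of_subset h1]; rw [pow_succ] at h; omega

end EdgeCount

/-! ### Decision trees and the search for an unknown edge -/

section Solves

variable [Fintype V] {Out : Type u} {P P' : SimpleGraph V → Prop} {Q : SimpleGraph V → Out → Prop}
  {c c' : ℕ}

lemma Solves.mono (h : Solves P Q c) (hP : ∀ G, P' G → P G) (hc : c ≤ c') : Solves P' Q c' := by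
  obtain ⟨alg, h⟩ := h
  exact ⟨alg, fun G hG => ⟨(h G (hP G hG)).1, (h G (hP G hG)).2.trans hc⟩⟩

lemma Solves.output (o : Out) (h : ∀ G, P G → Q G o) : Solves P Q c :=
  ⟨.output o, fun G hG => ⟨h G hG, Nat.zero_le _⟩⟩

lemma Solves.of_forall_not [Nonempty Out] (h : ∀ G, ¬ P G) : Solves P Q c :=
  .output (Classical.arbitrary Out) fun G hG => (h G hG).elim

lemma Solves.query (S : Finset V) (h : ∀ k : ℕ, Solves (fun G => P G ∧ cutSize G S = k) Q c) :
    Solves P Q (c + 1) := by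
  choose alg h using h
  refine ⟨.query S alg, fun G hG => ?_⟩
  have := h (cutSize G S) G ⟨hG, rfl⟩
  exact ⟨this.1, Nat.succ_le_succ this.2⟩

lemma Solves.queryEdges {X Y : Finset V} (hXY : Disjoint X Y)
    (h : ∀ k : ℤ, Solves (fun G => P G ∧ edgesBetween G X Y = k) Q c) : Solves P Q (c + 3) := by
  refine Solves.query X fun k₁ => Solves.query Y fun k₂ => Solves.query (X ∪ Y) fun k₃ => ?_
  refine (h (((k₁ : ℤ) + k₂ - k₃) / 2)).mono (fun G hG => ⟨hG.1.1.1, ?_⟩) le_rfl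
  have := two_mul_edgesBetween G hXY
  rw [hG.1.1.2, hG.1.2, hG.2] at this
  omega

/-- Halving one side costs one edge count. If the first half holds no unknown edge, the second half
must, without a further query. -/
lemma Solves.locate {kn : V → V → Prop} (k : ℕ) :
    ∀ (X Y : Finset V) (a b : ℕ) (P : SimpleGraph V → Prop), a + b = k → X.card ≤ 2 ^ a →
      Y.card ≤ 2 ^ b → Disjoint X Y →
      (∀ G, P G → ∀ u ∈ X, ∀ v ∈ Y, kn u v → G.Adj u v) →
      (∀ G, P G → ∃ u ∈ X, ∃ v ∈ Y, G.Adj u v ∧ ¬ kn u v) → Nonempty Out →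
      (∀ u ∈ X, ∀ v ∈ Y, ¬ kn u v → Solves (fun G => P G ∧ G.Adj u v) Q c) →
      Solves P Q (c + 3 * k) := by
  induction k with
  | zero =>
    intro X Y a b P hab hX hY _ hkn hex hO hs
    obtain ⟨rfl, rfl⟩ : a = 0 ∧ b = 0 := by omega
    by_cases hP : ∃ G, P G
    · obtain ⟨G, hG⟩ := hP
      obtain ⟨u, hu, v, hv, -, h2⟩ := hex G hG
      refine (hs u hu v hv h2).mono (fun G hG => ⟨hG, ?_⟩) (by omega)
      obtain ⟨u', hu', v', hv', h1', -⟩ := hex G hG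
      have e1 : u' = u := Finset.card_le_one.mp (by simpa using hX) _ hu' _ hu
      have e2 : v' = v := Finset.card_le_one.mp (by simpa using hY) _ hv' _ hv
      exact e1 ▸ e2 ▸ h1'
    · exact .of_forall_not fun G hG => hP ⟨G, hG⟩
  | succ k ih =>
    intro X Y a b P hab hX hY hd hkn hex hO hs
    rcases a with _ | a
    · obtain ⟨b, rfl⟩ : ∃ b', b = b' + 1 := ⟨k, by omega⟩
      obtain ⟨Y₁, Y₂, h12, rfl, hc1, hc2⟩ := exists_split Y hY
      rw [Finset.disjoint_union_right] at hd
      simp only [Finset.mem_union] at hkn hex hs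
      refine Solves.queryEdges (c := c + 3 * k) hd.1 fun q => ?_
      by_cases hq : q = ∑ u ∈ X, ∑ v ∈ Y₁, if kn u v then 1 else 0
      · refine ih X Y₂ 0 b _ (by omega) hX hc2 hd.2 (fun G hG u hu v hv => hkn G hG.1 u hu v (.inr hv))
          (fun G hG => ?_) hO fun u hu v hv hk =>
            (hs u hu v (.inr hv) hk).mono (fun G hG => ⟨hG.1.1, hG.2⟩) le_rfl
        have := (edgesBetween_eq_iff G fun u hu v hv => hkn G hG.1 u hu v (.inl hv)).1
          (hG.2.trans hq)
        obtain ⟨u, hu, v, hv | hv, h1, h2⟩ := hex G hG.1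
        · exact (h2 (this u hu v hv h1)).elim
        · exact ⟨u, hu, v, hv, h1, h2⟩
      · refine ih X Y₁ 0 b _ (by omega) hX hc1 hd.1 (fun G hG u hu v hv => hkn G hG.1 u hu v (.inl hv))
          (fun G hG => ?_) hO fun u hu v hv hk =>
            (hs u hu v (.inl hv) hk).mono (fun G hG => ⟨hG.1.1, hG.2⟩) le_rfl
        by_contra hcon
        push Not at hcon
        exact hq (hG.2.symm.trans
          ((edgesBetween_eq_iff G fun u hu v hv => hkn G hG.1 u hu v (.inl hv)).2 hcon))
    · obtain ⟨X₁, X₂, h12, rfl, hc1, hc2⟩ := exists_split X hX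
      rw [Finset.disjoint_union_left] at hd
      simp only [Finset.mem_union] at hkn hex hs
      refine Solves.queryEdges (c := c + 3 * k) hd.1 fun q => ?_
      by_cases hq : q = ∑ u ∈ X₁, ∑ v ∈ Y, if kn u v then 1 else 0
      · refine ih X₂ Y a b _ (by omega) hc2 hY hd.2 (fun G hG u hu v hv => hkn G hG.1 u (.inr hu) v hv)
          (fun G hG => ?_) hO fun u hu v hv hk =>
            (hs u (.inr hu) v hv hk).mono (fun G hG => ⟨hG.1.1, hG.2⟩) le_rfl
        have := (edgesBetween_eq_iff G fun u hu v hv => hkn G hG.1 u (.inl hu) v hv).1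
          (hG.2.trans hq)
        obtain ⟨u, hu | hu, v, hv, h1, h2⟩ := hex G hG.1
        · exact (h2 (this u hu v hv h1)).elim
        · exact ⟨u, hu, v, hv, h1, h2⟩
      · refine ih X₁ Y a b _ (by omega) hc1 hY hd.1 (fun G hG u hu v hv => hkn G hG.1 u (.inl hu) v hv)
          (fun G hG => ?_) hO fun u hu v hv hk =>
            (hs u (.inl hu) v hv hk).mono (fun G hG => ⟨hG.1.1, hG.2⟩) le_rfl
        by_contra hcon
        push Not at hcon
        exact hq (hG.2.symm.trans
          ((edgesBetween_eq_iff G fun u hu v hv => hkn G hG.1 u (.inl hu) v hv).2 hcon))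

/-- The number of queries that a binary search for an edge takes. -/
def findCost (V : Type u) [Fintype V] : ℕ := 3 * (2 * Nat.clog 2 (Fintype.card V)) + 3

lemma Solves.find [Nonempty Out] {X Y : Finset V} (hd : Disjoint X Y) {kn : V → V → Prop}
    (hkn : ∀ G, P G → ∀ u ∈ X, ∀ v ∈ Y, kn u v → G.Adj u v)
    (hnone : Solves (fun G => P G ∧ ∀ u ∈ X, ∀ v ∈ Y, G.Adj u v → kn u v) Q c)
    (hsome : ∀ u ∈ X, ∀ v ∈ Y, ¬ kn u v → Solves (fun G => P G ∧ G.Adj u v) Q c) :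
    Solves P Q (c + findCost V) := by
  have hcard : ∀ Z : Finset V, Z.card ≤ 2 ^ Nat.clog 2 (Fintype.card V) := fun Z =>
    (Finset.card_le_univ Z).trans (Nat.le_pow_clog one_lt_two _)
  refine Solves.queryEdges (c := c + 3 * (2 * Nat.clog 2 (Fintype.card V))) hd fun q => ?_
  by_cases hq : q = ∑ u ∈ X, ∑ v ∈ Y, if kn u v then 1 else 0
  · refine hnone.mono (fun G hG => ⟨hG.1, ?_⟩) (by omega)
    exact (edgesBetween_eq_iff G (hkn G hG.1)).1 (hG.2.trans hq)
  · refine Solves.locate (kn := kn) _ X Y _ _ _ (two_mul _).symm (hcard X) (hcard Y) hd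
      (fun G hG => hkn G hG.1) (fun G hG => ?_) inferInstance fun u hu v hv hk =>
        (hsome u hu v hv hk).mono (fun G hG => ⟨hG.1.1, hG.2⟩) le_rfl
    by_contra hcon
    push Not at hcon
    exact hq (hG.2.symm.trans ((edgesBetween_eq_iff G (hkn G hG.1)).2 hcon))

/-- Facts that can be learnt one at a time can be learnt for all members of a finite set. -/
lemma Solves.collect {ι α : Type*} [Nonempty α] {A : ι → SimpleGraph V → α → Prop} {cost : ι → ℕ}
    (I : Finset ι)
    (step : ∀ i ∈ I, ∀ (P : SimpleGraph V → Prop) (c : ℕ),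
      (∀ t, Solves (fun G => P G ∧ A i G t) Q c) → Solves P Q (c + cost i)) :
    ∀ (P : SimpleGraph V → Prop) (c : ℕ),
      (∀ T : ι → α, Solves (fun G => P G ∧ ∀ i ∈ I, A i G (T i)) Q c) →
        Solves P Q (c + ∑ i ∈ I, cost i) := by
  induction I using Finset.induction_on with
  | empty =>
    intro P c h
    exact (h fun _ => Classical.arbitrary α).mono (fun G hG => ⟨hG, by simp⟩) (by simp)
  | insert j I hj ih =>
    intro P c h
    rw [Finset.sum_insert hj, ← add_assoc]
    refine ih (fun i hi => step i (Finset.mem_insert_of_mem hi)) P _ fun T => ?_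
    refine step j (Finset.mem_insert_self j I) _ _ fun t => ?_
    refine (h (Function.update T j t)).mono (fun G hG => ⟨hG.1.1, fun i hi => ?_⟩) le_rfl
    by_cases hij : i = j
    · subst hij; simpa using hG.2
    · rw [Function.update_of_ne hij]
      exact hG.1.2 i ((Finset.mem_insert.mp hi).resolve_left hij)

end Solves

/-! ### Preflows, labels and the cut between two levels -/

/-- The value of the cut `S` in the network that `G` induces on `U`, with a source of capacity
`σ v` and a sink of capacity `ω v` at every vertex `v`. -/
noncomputable def networkCut (U : Finset V) (σ ω : V → ℤ) (G : SimpleGraph V) (S : Finset V) : ℤ :=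
  edgesBetween G S (U \ S) + ∑ v ∈ U \ S, σ v + ∑ v ∈ S, ω v

/-- What the vertex `v` receives and neither sends on nor delivers. -/
def excess (U : Finset V) (σ : V → ℤ) (f : V → V → ℤ) (y : V → ℤ) (v : V) : ℤ :=
  σ v - y v - ∑ w ∈ U, f v w

/-- `f` is a unit-capacity preflow on `U` with sources `σ` that delivers `y v ≤ ω v` at `v`. -/
structure IsPreflow (U : Finset V) (σ ω : V → ℤ) (f : V → V → ℤ) (y : V → ℤ) : Prop where
  antisymm : ∀ u v, f u v = -f v u
  le_one : ∀ u v, f u v ≤ 1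
  deliver_le : ∀ v ∈ U, y v ≤ ω v
  excess_nonneg : ∀ v ∈ U, 0 ≤ excess U σ f y v

/-- The flow `f` runs along edges of `G`, and the labels `d` drop by at most one along each
residual edge. -/
structure IsValidLabelling (U : Finset V) (f : V → V → ℤ) (d : V → ℕ) (G : SimpleGraph V) :
    Prop where
  adj : ∀ u v, f u v ≠ 0 → G.Adj u v
  label_le : ∀ u ∈ U, ∀ v ∈ U, G.Adj u v → f u v ≤ 0 → d u ≤ d v + 1

/-- The flow after sending one more unit along `(a, b)`. -/
noncomputable def push (f : V → V → ℤ) (a b : V) (u v : V) : ℤ :=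
  f u v + (if u = a ∧ v = b then 1 else 0) - (if u = b ∧ v = a then 1 else 0)

section Preflow

variable {U : Finset V} {σ ω : V → ℤ} {f : V → V → ℤ} {y : V → ℤ}

lemma sum_antisymm_eq_zero (hf : ∀ u v, f u v = -f v u) (A : Finset V) :
    ∑ u ∈ A, ∑ v ∈ A, f u v = 0 := by
  have h : ∑ u ∈ A, ∑ v ∈ A, f u v = -∑ u ∈ A, ∑ v ∈ A, f u v := by
    conv_lhs => rw [Finset.sum_comm]
    rw [← Finset.sum_neg_distrib]
    refine Finset.sum_congr rfl fun u _ => ?_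
    rw [← Finset.sum_neg_distrib]
    exact Finset.sum_congr rfl fun v _ => hf v u
  omega

/-- By antisymmetry the flow inside `A` cancels, so only flow across its boundary remains. -/
lemma sum_excess (hf : ∀ u v, f u v = -f v u) {A : Finset V} (hA : A ⊆ U) :
    ∑ v ∈ A, excess U σ f y v =
      ∑ v ∈ A, σ v - ∑ v ∈ A, y v - ∑ u ∈ A, ∑ v ∈ U \ A, f u v := by
  unfold excess
  rw [Finset.sum_sub_distrib, Finset.sum_sub_distrib]
  congr 1
  have : ∀ u, ∑ v ∈ U, f u v = ∑ v ∈ A, f u v + ∑ v ∈ U \ A, f u v := fun u => by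
    rw [add_comm, Finset.sum_sdiff hA]
  simp only [this, Finset.sum_add_distrib, sum_antisymm_eq_zero hf A, zero_add]

lemma IsPreflow.neg_one_le (h : IsPreflow U σ ω f y) (u v : V) : -1 ≤ f u v := by
  have h1 := h.antisymm u v
  have h2 := h.le_one v u
  omega

lemma IsPreflow.sum_deliver_le (h : IsPreflow U σ ω f y) : ∑ v ∈ U, y v ≤ ∑ v ∈ U, σ v := by
  have h1 := sum_excess (σ := σ) (y := y) h.antisymm (subset_refl U)
  have h2 : 0 ≤ ∑ v ∈ U, excess U σ f y v := Finset.sum_nonneg h.excess_nonneg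
  simp at h1
  omega

/-- A preflow delivers at most the value of any cut of a graph that contains its support. -/
lemma IsPreflow.sum_deliver_le_networkCut (h : IsPreflow U σ ω f y) {H : SimpleGraph V}
    (hH : ∀ u v, f u v ≠ 0 → H.Adj u v) {S : Finset V} (hS : S ⊆ U) :
    ∑ v ∈ U, y v ≤ networkCut U σ ω H S := by
  have h1 := sum_excess (σ := σ) (y := y) h.antisymm (Finset.sdiff_subset (s := U) (t := S))
  have h2 : 0 ≤ ∑ v ∈ U \ S, excess U σ f y v :=
    Finset.sum_nonneg fun v hv => h.excess_nonneg v (Finset.sdiff_subset hv)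
  have h3 : -∑ u ∈ U \ S, ∑ v ∈ U \ (U \ S), f u v ≤ edgesBetween H S (U \ S) := by
    rw [Finset.sdiff_sdiff_eq_self hS, edgesBetween_comm, edgesBetween, ← Finset.sum_neg_distrib]
    refine Finset.sum_le_sum fun u _ => ?_
    rw [← Finset.sum_neg_distrib]
    refine Finset.sum_le_sum fun v _ => ?_
    by_cases hu : H.Adj u v
    · have := h.neg_one_le u v; simp only [hu, if_true]; omega
    · have : f u v = 0 := by by_contra h0; exact hu (hH u v h0)
      simp [hu, this]
  have h4 : ∑ v ∈ S, y v ≤ ∑ v ∈ S, ω v := Finset.sum_le_sum fun v hv => h.deliver_le v (hS hv)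
  have h5 := Finset.sum_sdiff (f := y) hS
  unfold networkCut
  omega

lemma excess_push {a b : V} (ha : a ∈ U) (hb : b ∈ U) (v : V) :
    excess U σ (push f a b) y v =
      excess U σ f y v - (if v = a then 1 else 0) + (if v = b then 1 else 0) := by
  unfold excess push
  have h1 : ∑ w ∈ U, (if v = a ∧ w = b then (1 : ℤ) else 0) = if v = a then 1 else 0 := by
    by_cases h : v = a <;> simp [h, hb]
  have h2 : ∑ w ∈ U, (if v = b ∧ w = a then (1 : ℤ) else 0) = if v = b then 1 else 0 := by
    by_cases h : v = b <;> simp [h, ha]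
  rw [Finset.sum_sub_distrib, Finset.sum_add_distrib, h1, h2]
  ring

lemma IsPreflow.push (h : IsPreflow U σ ω f y) {a b : V} (ha : a ∈ U) (hb : b ∈ U) (hab : a ≠ b)
    (hex : 0 < excess U σ f y a) (hf : f a b ≠ 1) : IsPreflow U σ ω (push f a b) y where
  antisymm u v := by
    have := h.antisymm u v
    unfold CutQuery.push
    simp only [and_comm (a := v = a), and_comm (a := v = b)]
    omega
  le_one u v := by
    have h1 := h.le_one u v
    unfold CutQuery.push
    by_cases h2 : u = a ∧ v = b
    · obtain ⟨rfl, rfl⟩ := h2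
      split_ifs <;> omega
    · simp only [h2, if_false]; split_ifs <;> omega
  deliver_le := h.deliver_le
  excess_nonneg v hv := by
    have := h.excess_nonneg v hv
    rw [excess_push ha hb]
    by_cases h1 : v = a
    · subst h1; simp only [if_true]; split_ifs <;> omega
    · simp only [h1, if_false]; split_ifs <;> omega

lemma IsPreflow.deliver (h : IsPreflow U σ ω f y) {a : V} (hex : 0 < excess U σ f y a)
    (ha : y a < ω a) : IsPreflow U σ ω f (Function.update y a (y a + 1)) where
  antisymm := h.antisymm
  le_one := h.le_one
  deliver_le v hv := by
    by_cases hva : v = a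
    · subst hva; simp; omega
    · rw [Function.update_of_ne hva]; exact h.deliver_le v hv
  excess_nonneg v hv := by
    have h1 := h.excess_nonneg v hv
    unfold excess at *
    by_cases hva : v = a
    · subst hva; simp only [Function.update_self]; omega
    · rw [Function.update_of_ne hva]; exact h1

variable {d : V → ℕ} {G : SimpleGraph V}

lemma IsValidLabelling.push (h : IsValidLabelling U f d G) {a b : V} (hab : G.Adj a b)
    (hd : d b ≤ d a + 1) : IsValidLabelling U (push f a b) d G where
  adj u v huv := by
    unfold CutQuery.push at huv
    by_cases h1 : u = a ∧ v = b
    · obtain ⟨rfl, rfl⟩ := h1; exact hab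
    · by_cases h2 : u = b ∧ v = a
      · obtain ⟨rfl, rfl⟩ := h2; exact hab.symm
      · exact h.adj u v (by simpa [h1, h2] using huv)
  label_le u hu v hv huv hf := by
    unfold CutQuery.push at hf
    by_cases h2 : u = b ∧ v = a
    · obtain ⟨rfl, rfl⟩ := h2; exact hd
    · refine h.label_le u hu v hv huv ?_
      simp only [h2, if_false] at hf
      split_ifs at hf <;> omega

/-- Only residual edges from `a` to the level just below could violate the raised label, and all of
these are saturated. -/
lemma IsValidLabelling.relabel (h : IsValidLabelling U f d G) {a : V}
    (ha : ∀ v ∈ U, d v + 1 = d a → G.Adj a v → f a v = 1) :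
    IsValidLabelling U f (Function.update d a (d a + 1)) G where
  adj := h.adj
  label_le u hu v hv huv hf := by
    have h1 := h.label_le u hu v hv huv hf
    by_cases hua : u = a
    · subst hua
      have hvu : v ≠ u := huv.ne'
      rw [Function.update_self, Function.update_of_ne hvu]
      by_contra hcon
      have := ha v hv (by omega) huv
      omega
    · rw [Function.update_of_ne hua]
      by_cases hva : v = a
      · subst hva; rw [Function.update_self]; omega
      · rw [Function.update_of_ne hva]; exact h1

/-- If all excess sits at labels at least `D`, then some level set is a cut that exceeds the
delivered amount by at most twice the product of the sizes of two consecutive levels. -/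
lemma networkCut_level_le (h : IsPreflow U σ ω f y) (hv : IsValidLabelling U f d G) {D i : ℕ}
    (hi : i < D) (hy : ∀ v ∈ U, y v < ω v → d v = 0)
    (hex : ∀ v ∈ U, 0 < excess U σ f y v → D ≤ d v) :
    networkCut U σ ω G {v ∈ U | i + 1 ≤ d v} ≤ ∑ v ∈ U, y v +
      2 * (({v ∈ U | d v = i + 1} : Finset V).card * ({v ∈ U | d v = i} : Finset V).card) := by
  set S : Finset V := {v ∈ U | i + 1 ≤ d v} with hSdef
  have hS : S ⊆ U := Finset.filter_subset _ _
  have h1 := sum_excess (σ := σ) (y := y) h.antisymm (Finset.sdiff_subset (s := U) (t := S))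
  have h2 : ∑ v ∈ U \ S, excess U σ f y v = 0 := by
    refine Finset.sum_eq_zero fun v hvS => ?_
    simp only [hSdef, Finset.mem_sdiff, Finset.mem_filter, not_and, not_le] at hvS
    have := h.excess_nonneg v hvS.1
    have h3 := hex v hvS.1
    have h4 := hvS.2 hvS.1
    by_contra hne
    have := h3 (by omega)
    omega
  have h3 : ∑ v ∈ S, ω v = ∑ v ∈ S, y v := by
    refine Finset.sum_congr rfl fun v hvS => ?_
    simp only [hSdef, Finset.mem_filter] at hvS
    have h3 := h.deliver_le v hvS.1
    have h4 := hy v hvS.1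
    by_contra hne
    have := h4 (by omega)
    omega
  rw [Finset.sdiff_sdiff_eq_self hS] at h1
  have h5 := Finset.sum_sdiff (f := y) hS
  -- Unsaturated edges leaving `S` join level `i + 1` to level `i`. Each contributes `1 - f v u ≤
  -- 2`; saturated edges contribute nothing.
  have h6 : edgesBetween G S (U \ S) + ∑ u ∈ U \ S, ∑ v ∈ S, f u v ≤
      ∑ u ∈ S, ∑ v ∈ U \ S,
        2 * ((if d u = i + 1 then 1 else 0) * (if d v = i then (1 : ℤ) else 0)) := by
    rw [Finset.sum_comm, edgesBetween, ← Finset.sum_add_distrib]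
    refine Finset.sum_le_sum fun u hu => ?_
    rw [← Finset.sum_add_distrib]
    refine Finset.sum_le_sum fun v hv' => ?_
    simp only [hSdef, Finset.mem_sdiff, Finset.mem_filter, not_and, not_le] at hu hv'
    have a1 := h.antisymm u v
    have a2 := h.neg_one_le u v
    by_cases hA : G.Adj u v
    · by_cases hf : f u v ≤ 0
      · have := hv.label_le u hu.1 v hv'.1 hA hf
        have a3 := hv'.2 hv'.1
        have e1 : d u = i + 1 := by omega
        have e2 : d v = i := by omega
        simp only [hA, e1, e2, if_true]
        omega
      · have : 0 ≤ 2 * ((if d u = i + 1 then 1 else 0) * (if d v = i then (1 : ℤ) else 0)) := by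
          positivity
        simp only [hA, if_true]
        omega
    · have : f u v = 0 := by by_contra h0; exact hA (hv.adj u v h0)
      have : f v u = 0 := by omega
      simp only [hA, if_false, this]
      positivity
  have h7 : ∑ u ∈ S, ∑ v ∈ U \ S,
        2 * ((if d u = i + 1 then 1 else 0) * (if d v = i then (1 : ℤ) else 0)) ≤
      2 * (({v ∈ U | d v = i + 1} : Finset V).card * ({v ∈ U | d v = i} : Finset V).card) := by
    simp only [← Finset.mul_sum]
    rw [← Finset.sum_mul]
    rw [Finset.card_filter, Finset.card_filter]
    push_cast
    gcongr
    exact Finset.sdiff_subset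
  unfold networkCut
  omega

/-- Averaging: over `i < D`, each vertex is counted at most twice. -/
lemma exists_small_consecutive_levels (U : Finset V) (d : V → ℕ) {D : ℕ} (hD : 0 < D) :
    ∃ i < D, D * (({v ∈ U | d v = i + 1} : Finset V).card + ({v ∈ U | d v = i} : Finset V).card) ≤
      2 * U.card := by
  by_contra! hcon
  have h1 : ∀ g : V → ℕ → Prop, (∀ v i j, g v i → g v j → i = j) →
      ∑ i ∈ Finset.range D, ({v ∈ U | g v i} : Finset V).card ≤ U.card := by
    intro g hg
    simp only [Finset.card_filter]
    rw [Finset.sum_comm, Finset.card_eq_sum_ones]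
    refine Finset.sum_le_sum fun v _ => ?_
    rw [← Finset.card_filter, Finset.card_le_one]
    intro i hi j hj
    exact hg v i j (Finset.mem_filter.mp hi).2 (Finset.mem_filter.mp hj).2
  have h2 : ∑ i ∈ Finset.range D, ({v ∈ U | d v = i + 1} : Finset V).card ≤ U.card := by
    convert h1 (fun v i => d v = i + 1) fun v i j h h' => by omega
  have h3 : ∑ i ∈ Finset.range D, ({v ∈ U | d v = i} : Finset V).card ≤ U.card := by
    convert h1 (fun v i => d v = i) fun v i j h h' => by omega
  have h4 : ∑ _i ∈ Finset.range D, 2 * U.card < ∑ i ∈ Finset.range D,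
      D * (({v ∈ U | d v = i + 1} : Finset V).card + ({v ∈ U | d v = i} : Finset V).card) :=
    Finset.sum_lt_sum_of_nonempty (by simpa using hD.ne') fun i hi =>
      hcon i (Finset.mem_range.mp hi)
  rw [← Finset.mul_sum, ← Finset.mul_sum, Finset.sum_add_distrib, Finset.sum_const, Finset.card_range,
    smul_eq_mul, mul_left_comm] at h4
  have := lt_of_mul_lt_mul_left h4 (Nat.zero_le D)
  omega

lemma exists_networkCut_le (h : IsPreflow U σ ω f y) (hv : IsValidLabelling U f d G) {D n : ℕ}
    (hD : 0 < D) (hU : U.card ≤ n) (hn : n ^ 2 ≤ D ^ 3) (hy : ∀ v ∈ U, y v < ω v → d v = 0)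
    (hex : ∀ v ∈ U, 0 < excess U σ f y v → D ≤ d v) :
    ∃ S ⊆ U, networkCut U σ ω G S ≤ ∑ v ∈ U, y v + 2 * D := by
  obtain ⟨i, hi, hle⟩ := exists_small_consecutive_levels U d hD
  refine ⟨_, Finset.filter_subset _ _, (networkCut_level_le h hv hi hy hex).trans ?_⟩
  set p := ({v ∈ U | d v = i + 1} : Finset V).card
  set q := ({v ∈ U | d v = i} : Finset V).card
  -- From `p + q ≤ 2 * n / D` and AM-GM, `p * q ≤ (n / D) ^ 2 ≤ D`.
  have h1 : p * q ≤ D := by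
    have h2 : D * (p + q) ≤ 2 * n := by omega
    have h3 : (D * (p + q)) ^ 2 ≤ (2 * n) ^ 2 := Nat.pow_le_pow_left h2 2
    have h4 : 4 * (p * q) ≤ (p + q) ^ 2 := by zify; nlinarith [sq_nonneg ((p : ℤ) - q)]
    have h5 : D ^ 2 * (p * q) ≤ D ^ 2 * D := by nlinarith [Nat.mul_le_mul_left (D ^ 2) h4]
    exact le_of_mul_le_mul_left h5 (by positivity)
  have : (p : ℤ) * q ≤ D := by exact_mod_cast h1
  omega

end Preflow

/-! ### Push-relabel with few edge searches -/

section PushRelabel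

variable [Fintype V] {Out : Type u} {Q : SimpleGraph V → Out → Prop} {c : ℕ}
  {U : Finset V} {σ ω : V → ℤ} {D : ℕ} {P : SimpleGraph V → Prop}

/-- Push-relabel with labels up to `D`. -/
lemma Solves.pushRelabel_aux [Nonempty Out]
    (hQ : ∀ f y d, IsPreflow U σ ω f y → (∀ v ∈ U, y v < ω v → d v = 0) →
      (∀ v ∈ U, 0 < excess U σ f y v → D ≤ d v) →
      Solves (fun G => P G ∧ IsValidLabelling U f d G) Q c) (p : ℕ) :
    ∀ (f : V → V → ℤ) (y : V → ℤ) (d : V → ℕ) (h : ℕ), IsPreflow U σ ω f y →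
      (∀ v ∈ U, y v < ω v → d v = 0) → (∀ v ∈ U, d v ≤ D) →
      (D ≤ h ∨ ∃ v ∈ U, 0 < excess U σ f y v ∧ d v ≤ h) →
      2 * ∑ v ∈ U, ((D : ℤ) - d v) + (D + 1) * (∑ v ∈ U, σ v - ∑ v ∈ U, y v) + h ≤ p →
      Solves (fun G => P G ∧ IsValidLabelling U f d G) Q (c + findCost V * p) := by
  -- The potential bounded by `p` drops at every step. A relabel costs `2` and returns `1` through
  -- `h`. A push lowers `h` by `1`, because the next step can continue at the receiving vertex. A
  -- delivery releases `D + 1` and resets `h` to `D`.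
  induction p with
  | zero =>
    intro f y d h hf hy hd _ hp
    refine (hQ f y d hf hy fun v hv _ => ?_).mono (fun _ => id) (by omega)
    have h1 := hf.sum_deliver_le
    have h2 : ((D : ℤ) - d v) ≤ ∑ v ∈ U, ((D : ℤ) - d v) :=
      Finset.single_le_sum (f := fun v => (D : ℤ) - d v)
        (fun w hw => by have := hd w hw; omega) hv
    have h3 : 0 ≤ ((D : ℤ) + 1) * (∑ v ∈ U, σ v - ∑ v ∈ U, y v) :=
      mul_nonneg (by positivity) (by omega)
    push_cast at hp
    omega
  | succ p ih =>
    intro f y d h hf hy hd hh hp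
    by_cases hfin : ∀ v ∈ U, 0 < excess U σ f y v → D ≤ d v
    · exact (hQ f y d hf hy hfin).mono (fun _ => id) (by omega)
    push Not at hfin
    obtain ⟨a, ha, hea, haD, hah⟩ : ∃ a ∈ U, 0 < excess U σ f y a ∧ d a < D ∧ d a ≤ h := by
      obtain ⟨a, ha, hea, haD⟩ := hfin
      rcases hh with hh | ⟨b, hb, heb, hbh⟩
      · exact ⟨a, ha, hea, haD, by omega⟩
      · by_cases hbD : d b < D
        · exact ⟨b, hb, heb, hbD, hbh⟩
        · exact ⟨a, ha, hea, haD, by omega⟩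
    have hsum : ∀ g : V → ℤ, ∑ v ∈ U, g v = g a + ∑ v ∈ U \ {a}, g v := fun g =>
      Finset.sum_eq_add_sum_sdiff_singleton_of_mem ha g
    by_cases hya : y a < ω a
    · refine (ih f (Function.update y a (y a + 1)) d D (hf.deliver hea hya) (fun v hv hyv => ?_) hd
        (.inl le_rfl) ?_).mono (fun _ => id) (by rw [mul_add]; omega)
      · by_cases hva : v = a
        · subst hva; exact hy v hv hya
        · rw [Function.update_of_ne hva] at hyv; exact hy v hv hyv
      · have h1 : ∑ v ∈ U, Function.update y a (y a + 1) v = ∑ v ∈ U, y v + 1 := by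
          rw [Finset.sum_update_of_mem ha, hsum y]; ring
        rw [h1]
        push_cast at hp
        nlinarith
    · have hd1 : Disjoint ({a} : Finset V) {v ∈ U | d v + 1 = d a} := by
        simp
      rw [mul_add, mul_one, ← add_assoc]
      -- Only saturated pairs are excluded, so the search returns either an edge to push along or
      -- the certificate needed for a relabel.
      refine Solves.find hd1 (kn := fun u v => f u v = 1)
        (fun G hG u _ v _ huv => hG.2.adj u v (by omega)) ?_ ?_
      · refine (ih f y (Function.update d a (d a + 1)) (h + 1) hf (fun v hv hyv => ?_)
          (fun v hv => ?_) (.inr ⟨a, ha, hea, by simpa using hah⟩) ?_).mono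
          (fun G hG => ⟨hG.1.1, hG.1.2.relabel fun v hv hdv hA => ?_⟩) le_rfl
        · rw [Function.update_of_ne (by rintro rfl; exact hya hyv)]
          exact hy v hv hyv
        · by_cases hva : v = a
          · subst hva; simp; omega
          · rw [Function.update_of_ne hva]; exact hd v hv
        · have h1 : ∑ v ∈ U, ((D : ℤ) - (Function.update d a (d a + 1) v : ℕ)) =
              ∑ v ∈ U, ((D : ℤ) - d v) - 1 := by
            rw [hsum, hsum fun v => (D : ℤ) - d v]
            have : ∑ v ∈ U \ {a}, ((D : ℤ) - (Function.update d a (d a + 1) v : ℕ)) =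
                ∑ v ∈ U \ {a}, ((D : ℤ) - d v) := by
              refine Finset.sum_congr rfl fun v hv => ?_
              rw [Function.update_of_ne (by simpa using (Finset.mem_sdiff.mp hv).2)]
            rw [this]
            simp only [Function.update_self]
            push_cast
            ring
          rw [h1]
          push_cast at hp ⊢
          linarith
        · exact hG.2 a (by simp) v (by simp [hv, hdv]) hA
      · intro u hu b hb hab
        obtain rfl : u = a := by simpa using hu
        obtain ⟨hbU, hdb⟩ := Finset.mem_filter.mp hb
        have hne : u ≠ b := by rintro rfl; omega
        obtain ⟨h, rfl⟩ : ∃ h', h = h' + 1 := ⟨h - 1, by omega⟩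
        refine (ih (push f u b) y d h (hf.push ha hbU hne hea hab) hy hd
          (.inr ⟨b, hbU, ?_, by omega⟩) ?_).mono
          (fun G hG => ⟨hG.1.1, hG.1.2.push hG.2 (by omega)⟩) le_rfl
        · have := hf.excess_nonneg b hbU
          rw [excess_push ha hbU]
          simp only [hne.symm, if_false, if_true]
          omega
        · push_cast at hp ⊢
          linarith

lemma Solves.pushRelabel [Nonempty Out] (hσ : ∀ v ∈ U, 0 ≤ σ v) (hω : ∀ v ∈ U, 0 ≤ ω v)
    {F : ℕ} (hF : ∑ v ∈ U, σ v ≤ F)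
    (hQ : ∀ f y d, IsPreflow U σ ω f y → (∀ v ∈ U, y v < ω v → d v = 0) →
      (∀ v ∈ U, 0 < excess U σ f y v → D ≤ d v) →
      Solves (fun G => P G ∧ IsValidLabelling U f d G) Q c) :
    Solves P Q (c + findCost V * (2 * U.card * D + (D + 1) * F + D)) := by
  refine (Solves.pushRelabel_aux hQ _ (fun _ _ => 0) (fun _ => 0) (fun _ => 0) D
    ⟨by simp, by simp, hω, by simpa [excess] using hσ⟩ (by simp) (by simp) (.inl le_rfl) ?_).mono
    (fun G hG => ⟨hG, by simp, by simp⟩) le_rfl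
  simp only [Finset.sum_const, smul_zero, sub_zero, Nat.cast_zero, nsmul_eq_mul]
  push_cast
  nlinarith [mul_le_mul_of_nonneg_left hF (by positivity : (0 : ℤ) ≤ D + 1)]

end PushRelabel

/-! ### Submodularity and least minimum cuts -/

section LeastMinimizer

variable {U : Finset V} {σ ω : V → ℤ} {G H : SimpleGraph V}

/-- With an index set independent of `S`, submodularity can be checked pair by pair. -/
lemma edgesBetween_sdiff_eq {S : Finset V} (hS : S ⊆ U) :
    edgesBetween G S (U \ S) =
      ∑ u ∈ U, ∑ v ∈ U, if u ∈ S ∧ v ∉ S ∧ G.Adj u v then 1 else 0 := by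
  have e1 : S = {u ∈ U | u ∈ S} := by ext v; simp; exact fun h => hS h
  have e2 : U \ S = {v ∈ U | v ∉ S} := by ext v; simp
  unfold edgesBetween
  rw [e2]
  conv_lhs => rw [e1]
  simp only [Finset.sum_filter]
  refine Finset.sum_congr rfl fun u _ => ?_
  by_cases h : u ∈ S
  · simp only [h, true_and, if_true]
    refine Finset.sum_congr rfl fun v hv => ?_
    simp only [Finset.mem_filter, ite_and, hv, true_and]
  · simp [h]

lemma edgesBetween_sdiff_submodular {S T : Finset V} (hS : S ⊆ U) (hT : T ⊆ U) :
    edgesBetween G (S ∩ T) (U \ (S ∩ T)) + edgesBetween G (S ∪ T) (U \ (S ∪ T)) ≤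
      edgesBetween G S (U \ S) + edgesBetween G T (U \ T) := by
  rw [edgesBetween_sdiff_eq hS, edgesBetween_sdiff_eq hT,
    edgesBetween_sdiff_eq (Finset.inter_subset_left.trans hS),
    edgesBetween_sdiff_eq (Finset.union_subset hS hT)]
  simp only [← Finset.sum_add_distrib]
  refine Finset.sum_le_sum fun u _ => Finset.sum_le_sum fun v _ => ?_
  by_cases hA : G.Adj u v
  · by_cases h1 : u ∈ S <;> by_cases h2 : u ∈ T <;> by_cases h3 : v ∈ S <;> by_cases h4 : v ∈ T <;>
      simp [hA, h1, h2, h3, h4]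
  · simp [hA]

lemma networkCut_submodular {S T : Finset V} (hS : S ⊆ U) (hT : T ⊆ U) :
    networkCut U σ ω G (S ∩ T) + networkCut U σ ω G (S ∪ T) ≤
      networkCut U σ ω G S + networkCut U σ ω G T := by
  have h1 := edgesBetween_sdiff_submodular (G := G) hS hT
  have h2 := Finset.sum_union_inter (f := ω) (s₁ := S) (s₂ := T)
  have h3 := Finset.sum_union_inter (f := σ) (s₁ := S) (s₂ := T)
  have h4 := Finset.sum_sdiff (f := σ) hS
  have h5 := Finset.sum_sdiff (f := σ) hT
  have h6 := Finset.sum_sdiff (f := σ) (Finset.inter_subset_left.trans hS : S ∩ T ⊆ U)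
  have h7 := Finset.sum_sdiff (f := σ) (Finset.union_subset hS hT)
  unfold networkCut
  omega

lemma networkCut_mono (h : H ≤ G) (S : Finset V) :
    networkCut U σ ω H S ≤ networkCut U σ ω G S := by
  have := edgesBetween_mono h S (U \ S)
  unfold networkCut
  omega

lemma edgesBetween_lt (h : H ≤ G) {X Y : Finset V} {u v : V} (hu : u ∈ X) (hv : v ∈ Y)
    (hG : G.Adj u v) (hH : ¬ H.Adj u v) : edgesBetween H X Y < edgesBetween G X Y := by
  refine lt_of_le_of_ne (edgesBetween_mono h X Y) fun heq => hH ?_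
  exact (edgesBetween_eq_iff (kn := H.Adj) G fun _ _ _ _ h' => h h').1 heq.symm u hu v hv hG

/-- Minimum cuts of a network have a least element. -/
lemma exists_least_minimizer (U : Finset V) (σ ω : V → ℤ) (G : SimpleGraph V) :
    ∃ S ⊆ U, (∀ S' ⊆ U, networkCut U σ ω G S ≤ networkCut U σ ω G S') ∧
      ∀ S' ⊆ U, networkCut U σ ω G S' = networkCut U σ ω G S → S ⊆ S' := by
  obtain ⟨S₀, hS₀, hmin₀⟩ := Finset.exists_min_image U.powerset (networkCut U σ ω G)
    ⟨U, Finset.mem_powerset_self U⟩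
  simp only [Finset.mem_powerset] at hS₀ hmin₀
  -- A minimizer of smallest cardinality is least, since by submodularity its intersection with any
  -- other minimizer is again one.
  obtain ⟨S, hS, hmin⟩ := Finset.exists_min_image
    {S ∈ U.powerset | networkCut U σ ω G S = networkCut U σ ω G S₀} Finset.card
    ⟨S₀, by simp [hS₀]⟩
  simp only [Finset.mem_powerset, Finset.mem_filter] at hS hmin
  refine ⟨S, hS.1, fun S' hS' => hS.2 ▸ hmin₀ S' hS', fun S' hS' heq => ?_⟩
  have h1 := networkCut_submodular (σ := σ) (ω := ω) (G := G) hS.1 hS'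
  have h2 := hmin₀ _ (Finset.union_subset hS.1 hS')
  have hsub : S ∩ S' ⊆ U := Finset.inter_subset_left.trans hS.1
  have h3 := hmin₀ _ hsub
  have h4 := hmin (S ∩ S') ⟨hsub, by omega⟩
  exact Finset.inter_eq_left.mp (Finset.eq_of_subset_of_card_le Finset.inter_subset_left h4)

end LeastMinimizer

/-! ### Exact minimum cuts -/

section MinCut

variable [Fintype V] {Out : Type u} {Q : SimpleGraph V → Out → Prop} {c : ℕ}
  {U : Finset V} {σ ω : V → ℤ} {P : SimpleGraph V → Prop}

/-- A minimum cut can be found by learning, one edge at a time, the edges across the least minimum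
cut of the known subgraph. -/
lemma Solves.learnMinCut [Nonempty Out] {B : ℤ}
    (hB : ∀ G, P G → ∃ S ⊆ U, networkCut U σ ω G S ≤ B)
    (hQ : ∀ S ⊆ U, Solves (fun G => P G ∧
      ∀ S' ⊆ U, networkCut U σ ω G S ≤ networkCut U σ ω G S') Q c) (p : ℕ) :
    ∀ (H : SimpleGraph V) (S : Finset V), S ⊆ U →
      (∀ S' ⊆ U, networkCut U σ ω H S ≤ networkCut U σ ω H S') →
      (∀ S' ⊆ U, networkCut U σ ω H S' = networkCut U σ ω H S → S ⊆ S') →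
      (U.card + 1) * (B - networkCut U σ ω H S) + (U.card - S.card) < p →
      Solves (fun G => P G ∧ H ≤ G) Q (c + findCost V * p) := by
  induction p with
  | zero =>
    -- The budget cannot run out: the minimum for `H ≤ G` never exceeds `B`.
    intro H S hS hmin hleast hp
    refine .of_forall_not fun G hG => ?_
    obtain ⟨S', hS', hle⟩ := hB G hG.1
    have h1 := hmin S' hS'
    have h2 := networkCut_mono (U := U) (σ := σ) (ω := ω) hG.2 S'
    have h3 := Finset.card_le_card hS
    have h4 : 0 ≤ ((U.card : ℤ) + 1) * (B - networkCut U σ ω H S) :=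
      mul_nonneg (by positivity) (by omega)
    push_cast at hp
    omega
  | succ p ih =>
    intro H S hS hmin hleast hp
    rw [mul_add, mul_one, ← add_assoc]
    refine Solves.find (X := S) (Y := U \ S) Finset.disjoint_sdiff (kn := H.Adj)
      (fun G hG u _ v _ h => hG.2 h) ?_ fun u hu v hv huv => ?_
    · refine (hQ S hS).mono (fun G hG => ⟨hG.1.1, fun S' hS' => ?_⟩) (by omega)
      have h1 := (edgesBetween_eq_iff (X := S) (Y := U \ S) (kn := H.Adj) G
        fun _ _ _ _ h => hG.1.2 h).2 hG.2
      have h2 : networkCut U σ ω G S = networkCut U σ ω H S := by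
        unfold networkCut
        rw [h1]
        rfl
      rw [h2]
      exact (hmin S' hS').trans (networkCut_mono hG.1.2 S')
    · have hle : H ≤ H ⊔ SimpleGraph.edge u v := le_sup_left
      have hne : u ≠ v := by
        rintro rfl; exact (Finset.mem_sdiff.mp hv).2 hu
      obtain ⟨S', hS', hmin', hleast'⟩ := exists_least_minimizer U σ ω (H ⊔ SimpleGraph.edge u v)
      refine (ih _ S' hS' hmin' hleast' ?_).mono (fun G hG => ⟨hG.1.1, sup_le hG.1.2 ?_⟩) le_rfl
      · have h1 := hmin S' hS'
        have h2 := networkCut_mono (U := U) (σ := σ) (ω := ω) hle S'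
        have h3 := Finset.card_le_card hS
        have h4 := Finset.card_le_card hS'
        push_cast at hp
        -- If the minimum is unchanged, `S'` was already a minimizer for `H`, so it contains `S`; it
        -- differs from `S`, whose value has grown. Otherwise the minimum grows by at least one, and
        -- the weight `|U| + 1` pays for any loss in cardinality.
        by_cases heq : networkCut U σ ω (H ⊔ SimpleGraph.edge u v) S' = networkCut U σ ω H S
        · have h5 := hleast S' hS' (by omega)
          have h6 : S ≠ S' := by
            rintro rfl
            have h7 := edgesBetween_lt hle hu hv
              (by simp [SimpleGraph.edge_adj, hne]) huv
            unfold networkCut at heq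
            omega
          have h7 := Finset.card_lt_card (lt_of_le_of_ne h5 h6)
          rw [heq]
          omega
        · have h5 : networkCut U σ ω H S + 1 ≤
              networkCut U σ ω (H ⊔ SimpleGraph.edge u v) S' := by omega
          nlinarith [mul_le_mul_of_nonneg_left h5 (by positivity : (0 : ℤ) ≤ U.card + 1)]
      · exact (SimpleGraph.edge_le_iff _).2 (.inr hG.2)

/-- The number of queries for a minimum cut in a network with `m` vertices and total source
capacity `F`, with labels up to `D`. -/
def minCutCost (V : Type u) [Fintype V] (D m F : ℕ) : ℕ :=
  findCost V * ((m + 1) * (2 * D + 1)) + findCost V * (2 * m * D + (D + 1) * F + D)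

/-- The support of the final preflow is a known subgraph whose minimum cut is at least the delivered
amount. Learning therefore starts within `2 * D` of the true minimum. -/
lemma Solves.minNetworkCut [Nonempty Out] {D : ℕ} (hD : 0 < D)
    (hn : Fintype.card V ^ 2 ≤ D ^ 3) (hσ : ∀ v ∈ U, 0 ≤ σ v) (hω : ∀ v ∈ U, 0 ≤ ω v)
    {F : ℕ} (hF : ∑ v ∈ U, σ v ≤ F)
    (hQ : ∀ S : Finset V, Solves (fun G => P G ∧ S ⊆ U ∧
      ∀ S' ⊆ U, networkCut U σ ω G S ≤ networkCut U σ ω G S') Q c) :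
    Solves P Q (c + minCutCost V D U.card F) := by
  rw [minCutCost, ← add_assoc]
  refine Solves.pushRelabel (D := D) hσ hω hF fun f y d hf hy hd => ?_
  let H : SimpleGraph V :=
    { Adj := fun u v => f u v ≠ 0
      symm := ⟨fun u v h => by have := hf.antisymm u v; omega⟩
      loopless := ⟨fun u h => by have := hf.antisymm u u; omega⟩ }
  obtain ⟨S, hS, hmin, hleast⟩ := exists_least_minimizer U σ ω H
  have hY : ∑ v ∈ U, y v ≤ networkCut U σ ω H S :=
    hf.sum_deliver_le_networkCut (fun _ _ h => h) hS
  refine (Solves.learnMinCut (P := fun G => P G ∧ IsValidLabelling U f d G)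
    (B := ∑ v ∈ U, y v + 2 * D)
    (fun G hG => exists_networkCut_le hf hG.2 hD (Finset.card_le_univ U) hn hy hd)
    (fun S hS => (hQ S).mono (fun G hG => ⟨hG.1.1, hS, hG.2⟩) le_rfl) _ H S hS hmin hleast
    ?_).mono (fun G hG => ⟨hG, fun u v h => hG.2.adj u v h⟩) le_rfl
  have h3 := Finset.card_le_card hS
  push_cast
  nlinarith [mul_le_mul_of_nonneg_left hY (by positivity : (0 : ℤ) ≤ U.card + 1)]

end MinCut

/-! ### Trimming isolating cuts to disjoint regions -/

section Uncrossing

variable {σ ω : V → ℤ} {G : SimpleGraph V}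

/-- The capacity `τ + 1` at each vertex of `A`. -/
noncomputable def capacity (τ : ℕ) (A : Finset V) (v : V) : ℤ := if v ∈ A then τ + 1 else 0

lemma capacity_nonneg (τ : ℕ) (A : Finset V) (v : V) : 0 ≤ capacity τ A v := by
  unfold capacity; split_ifs <;> omega

lemma isIsolatingCut_iff {R : Finset V} {r : V} {C : Finset V} :
    IsIsolatingCut R r C ↔ r ∈ C ∧ ∀ v ∈ C, v ∈ R → v = r := by
  simp only [IsIsolatingCut, IsSeparatingCut, Set.singleton_subset_iff, Finset.mem_coe,
    Set.disjoint_left, Set.mem_sdiff, Set.mem_singleton_iff]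
  constructor
  · rintro ⟨h1, h2⟩
    exact ⟨h1, fun v hv hR => by by_contra hne; exact h2 ⟨hR, hne⟩ hv⟩
  · rintro ⟨h1, h2⟩
    exact ⟨h1, fun v hv hC => hv.2 (h2 v hC hv.1)⟩

variable [Fintype V]

lemma networkCut_univ (S : Finset V) :
    networkCut Finset.univ σ ω G S = cutSize G S + ∑ v ∈ Sᶜ, σ v + ∑ v ∈ S, ω v := by
  rw [networkCut, ← Finset.compl_eq_univ_sdiff, cutSize_eq_edgesBetween]

lemma networkCut_univ_compl (S : Finset V) :
    networkCut Finset.univ ω σ G Sᶜ = networkCut Finset.univ σ ω G S := by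
  rw [networkCut_univ, networkCut_univ, cutSize_eq_edgesBetween, cutSize_eq_edgesBetween,
    compl_compl, edgesBetween_comm]
  ring

/-- Cutting down an isolating cut of `r` to the side of `r` in a minimum cut of the network does not
increase its size. -/
lemma cutSize_inter_le (hσ : ∀ v, 0 ≤ σ v) (hω : ∀ v, 0 ≤ ω v) {S C : Finset V} {r : V} {τ : ℕ}
    (hS : ∀ S', networkCut Finset.univ σ ω G S ≤ networkCut Finset.univ σ ω G S')
    (hr : r ∈ C) (hωC : ∀ v ∈ C, ω v = 0) (hσr : σ r = τ + 1) (hC : cutSize G C ≤ τ) :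
    r ∈ S ∧ cutSize G (C ∩ S) ≤ cutSize G C := by
  have h1 := networkCut_submodular (σ := σ) (ω := ω) (G := G) (Finset.subset_univ C)
    (Finset.subset_univ S)
  have h2 := hS (C ∪ S)
  have h3 : networkCut Finset.univ σ ω G (C ∩ S) ≤ networkCut Finset.univ σ ω G C := by omega
  rw [networkCut_univ, networkCut_univ, Finset.sum_eq_zero hωC] at h3
  have h4 : 0 ≤ ∑ v ∈ C ∩ S, ω v := Finset.sum_nonneg fun v _ => hω v
  have h5 : Cᶜ ⊆ (C ∩ S)ᶜ := by
    rw [Finset.compl_subset_compl]; exact Finset.inter_subset_left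
  have h6 : r ∈ S := by
    -- If `r` were missing from `S`, its source would add `τ + 1` to the value of `C ∩ S`, more than
    -- the whole size of `C`.
    by_contra hrS
    have h7 : insert r Cᶜ ⊆ (C ∩ S)ᶜ := Finset.insert_subset (by simp [hrS]) h5
    have h8 := Finset.sum_le_sum_of_subset_of_nonneg (f := σ) h7 fun v _ _ => hσ v
    rw [Finset.sum_insert (by simpa using hr)] at h8
    omega
  refine ⟨h6, ?_⟩
  have h8 := Finset.sum_le_sum_of_subset_of_nonneg (f := σ) h5 fun v _ _ => hσ v
  omega

lemma sum_capacity_le (τ : ℕ) (A U : Finset V) :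
    ∑ v ∈ U, capacity τ A v ≤ (A.card * (τ + 1) : ℕ) := by
  refine (Finset.sum_le_sum_of_subset_of_nonneg (Finset.subset_univ U) fun v _ _ =>
    capacity_nonneg τ A v).trans ?_
  simp [capacity, Finset.sum_ite_mem]

/-- The `i`-th digit in a binary numbering of the vertices. -/
noncomputable def digit (v : V) (i : ℕ) : Bool := (Fintype.equivFin V v : ℕ).testBit i

lemma exists_digit_ne {u v : V} (h : u ≠ v) :
    ∃ i < Nat.clog 2 (Fintype.card V), digit u i ≠ digit v i := by
  by_contra! hcon
  refine h ((Fintype.equivFin V).injective (Fin.ext (Nat.eq_of_testBit_eq fun i => ?_)))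
  by_cases hi : i < Nat.clog 2 (Fintype.card V)
  · exact hcon i hi
  · have hlt : ∀ w : V, (Fintype.equivFin V w : ℕ) < 2 ^ i := fun w =>
      (Fintype.equivFin V w).isLt.trans_le ((Nat.le_pow_clog one_lt_two _).trans
        (Nat.pow_le_pow_right two_pos (not_lt.mp hi)))
    rw [Nat.testBit_lt_two_pow (hlt u), Nat.testBit_lt_two_pow (hlt v)]

/-- The side of `T i` on which `r` has to lie. -/
noncomputable def side (T : ℕ → Finset V) (r : V) (i : ℕ) : Finset V :=
  if digit r i then T i else (T i)ᶜ

/-- The region in which an isolating cut of `r` is to be searched. -/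
noncomputable def region (T : ℕ → Finset V) (R : Finset V) (r : V) : Finset V :=
  insert r (({v | ∀ i < Nat.clog 2 (Fintype.card V), v ∈ side T r i} : Finset V) \ R)

lemma pairwiseDisjoint_region (T : ℕ → Finset V) (R : Finset V) :
    (R : Set V).PairwiseDisjoint (region T R) := by
  intro r hr r' hr' hne
  simp only [Finset.mem_coe] at hr hr'
  refine Finset.disjoint_left.mpr fun v hv hv' => ?_
  simp only [region, Finset.mem_insert, Finset.mem_sdiff, Finset.mem_filter, Finset.mem_univ,
    true_and] at hv hv'
  rcases hv with rfl | hv <;> rcases hv' with rfl | hv'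
  · exact hne rfl
  · exact hv'.2 hr
  · exact hv.2 hr'
  -- At a digit where the terminals differ, their sides are complementary.
  · obtain ⟨i, hi, hd⟩ := exists_digit_ne hne
    have h1 := hv.1 i hi
    have h2 := hv'.1 i hi
    unfold side at h1 h2
    cases h3 : digit r i <;> cases h4 : digit r' i <;> simp_all

lemma sum_card_region_le (T : ℕ → Finset V) (R : Finset V) :
    ∑ r ∈ R, (region T R r).card ≤ Fintype.card V := by
  rw [← Finset.card_biUnion (pairwiseDisjoint_region T R)]
  exact Finset.card_le_univ _

lemma isIsolatingCut_of_subset_region {T : ℕ → Finset V} {R : Finset V} {r : V} {C : Finset V}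
    (hC : C ⊆ region T R r) (hr : r ∈ C) : IsIsolatingCut R r C := by
  refine isIsolatingCut_iff.2 ⟨hr, fun v hv hR => ?_⟩
  have := hC hv
  simp only [region, Finset.mem_insert, Finset.mem_sdiff] at this
  tauto

/-- The terminals whose `i`-th digit is `b`. -/
noncomputable def terminals (R : Finset V) (b : Bool) (i : ℕ) : Finset V := {v ∈ R | digit v i = b}

/-- `S` is a minimum cut between the terminals whose `i`-th digits are `1` and `0`, where each
terminal counts for at most `τ + 1`. -/
def IsDigitCut (R : Finset V) (τ i : ℕ) (G : SimpleGraph V) (S : Finset V) : Prop :=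
  S ⊆ Finset.univ ∧ ∀ S' ⊆ Finset.univ,
    networkCut Finset.univ (capacity τ (terminals R true i)) (capacity τ (terminals R false i)) G S ≤
      networkCut Finset.univ (capacity τ (terminals R true i)) (capacity τ (terminals R false i)) G S'

/-- Trimming by one digit cut at a time keeps `r`, never increases the size, and preserves earlier
trimmings. The only terminal in an isolating cut is `r`, so the opposite capacities vanish on it. -/
lemma exists_subset_region {R : Finset V} {τ : ℕ} {T : ℕ → Finset V}
    (hT : ∀ i ∈ Finset.range (Nat.clog 2 (Fintype.card V)), IsDigitCut R τ i G (T i))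
    {r : V} (hr : r ∈ R) {C : Finset V} (hC : IsIsolatingCut R r C) (hle : cutSize G C ≤ τ) :
    ∃ C' ⊆ region T R r, r ∈ C' ∧ cutSize G C' ≤ cutSize G C := by
  rw [isIsolatingCut_iff] at hC
  have key : ∀ j ≤ Nat.clog 2 (Fintype.card V), ∃ C' ⊆ C, r ∈ C' ∧ cutSize G C' ≤ cutSize G C ∧
      ∀ v ∈ C', ∀ i < j, v ∈ side T r i := by
    intro j
    induction j with
    | zero => exact fun _ => ⟨C, subset_rfl, hC.1, le_rfl, fun _ _ _ h => absurd h (by omega)⟩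
    | succ j ih =>
      intro hj
      obtain ⟨C', hsub, hrC, hle', hC'⟩ := ih (by omega)
      have hmin := (hT j (Finset.mem_range.mpr (by omega))).2
      have hcap : ∀ v ∈ C', ∀ b, b ≠ digit r j → capacity τ (terminals R b j) v = 0 := by
        intro v hv b hb
        have := hC.2 v (hsub hv)
        simp only [capacity, terminals, Finset.mem_filter]
        rw [if_neg]
        rintro ⟨hvR, hvb⟩
        rw [this hvR] at hvb
        exact hb hvb.symm
      have hcap' : capacity τ (terminals R (digit r j) j) r = τ + 1 := by
        simp [capacity, terminals, hr]
      have h1 : r ∈ side T r j ∧ cutSize G (C' ∩ side T r j) ≤ cutSize G C' := by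
        unfold side
        -- For digit `0` the terminal is on the sink side; complementing the cut exchanges sources
        -- and sinks.
        cases hd : digit r j
        · rw [hd] at hcap'
          refine cutSize_inter_le (capacity_nonneg τ (terminals R false j))
            (capacity_nonneg τ (terminals R true j)) (fun S' => ?_) hrC
            (fun v hv => hcap v hv true (by simp [hd])) hcap' (hle'.trans hle)
          have := hmin S'ᶜ (Finset.subset_univ _)
          rw [← networkCut_univ_compl S'ᶜ, compl_compl] at this
          simpa [networkCut_univ_compl] using this
        · rw [hd] at hcap'
          exact cutSize_inter_le (capacity_nonneg τ (terminals R true j))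
            (capacity_nonneg τ (terminals R false j)) (fun S' => hmin S' (Finset.subset_univ _)) hrC
            (fun v hv => hcap v hv false (by simp [hd])) hcap' (hle'.trans hle)
      refine ⟨C' ∩ side T r j, Finset.inter_subset_left.trans hsub,
        Finset.mem_inter.mpr ⟨hrC, h1.1⟩, h1.2.trans hle', fun v hv i hi => ?_⟩
      rw [Finset.mem_inter] at hv
      rcases Nat.lt_succ_iff_lt_or_eq.mp hi with hi | rfl
      · exact hC' v hv.1 i hi
      · exact hv.2
  obtain ⟨C', hsub, hrC, hle', hC'⟩ := key _ le_rfl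
  refine ⟨C', fun v hv => ?_, hrC, hle'⟩
  have := hC.2 v (hsub hv)
  simp only [region, Finset.mem_insert, Finset.mem_sdiff, Finset.mem_filter, Finset.mem_univ,
    true_and]
  by_cases hvR : v ∈ R
  · exact .inl (this hvR)
  · exact .inr ⟨hC' v hv, hvR⟩

/-- The size of a cut, plus `τ + 1` if it misses `r`. -/
noncomputable def penalizedCutSize (τ : ℕ) (r : V) (G : SimpleGraph V) (S : Finset V) : ℕ :=
  cutSize G S + if r ∈ S then 0 else τ + 1

/-- `S` is a cut within `U` of least penalized size. -/
def IsRegionCut (U : Finset V) (τ : ℕ) (r : V) (G : SimpleGraph V) (S : Finset V) : Prop :=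
  S ⊆ U ∧ ∀ S' ⊆ U, penalizedCutSize τ r G S ≤ penalizedCutSize τ r G S'

/-- Edges leaving the region are charged as sink capacities at their inner endpoints, as if the
outside were contracted to the sink. -/
lemma networkCut_eq_penalizedCutSize {U S : Finset V} {r : V} {τ : ℕ} (hr : r ∈ U)
    (hω : ∀ v ∈ U, edgesBetween G {v} Uᶜ = ω v) (hS : S ⊆ U) :
    networkCut U (capacity τ {r}) ω G S = penalizedCutSize τ r G S := by
  have h1 : ∑ v ∈ S, ω v = edgesBetween G S Uᶜ := by
    rw [edgesBetween_eq_sum_left]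
    exact Finset.sum_congr rfl fun v hv => (hω v (hS hv)).symm
  have h2 : Sᶜ = U \ S ∪ Uᶜ := by
    ext v; have := @hS v; simp; tauto
  have h3 : Disjoint (U \ S) Uᶜ := by
    rw [Finset.disjoint_left]; intro v; simp; tauto
  have h4 : ∑ v ∈ U \ S, capacity τ {r} v = if r ∈ S then 0 else (τ : ℤ) + 1 := by
    simp only [capacity, Finset.mem_singleton, Finset.sum_ite_eq', Finset.mem_sdiff, hr, true_and,
      ite_not]
  rw [networkCut, penalizedCutSize, h1, h4]
  push_cast
  rw [cutSize_eq_edgesBetween, h2, edgesBetween_union_right G S h3]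
  ring

/-- The answer read off from the cuts `C r` that were found in the regions of the terminals. -/
lemma exists_isIsolatingCutAnswer {R : Finset V} {τ : ℕ} (T : ℕ → Finset V) (C : V → Finset V)
    (k : V → ℕ) : ∃ ans : Option (Finset V), ∀ G : SimpleGraph V,
      (∀ i ∈ Finset.range (Nat.clog 2 (Fintype.card V)), IsDigitCut R τ i G (T i)) →
      (∀ r ∈ R, IsRegionCut (region T R r) τ r G (C r)) → (∀ r ∈ R, cutSize G (C r) = k r) →
      IsIsolatingCutAnswer G R τ ans := by
  have key : ∀ G : SimpleGraph V,
      (∀ i ∈ Finset.range (Nat.clog 2 (Fintype.card V)), IsDigitCut R τ i G (T i)) →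
      (∀ r ∈ R, IsRegionCut (region T R r) τ r G (C r)) → (∀ r ∈ R, cutSize G (C r) = k r) →
      ∀ r ∈ R, ∀ C', IsIsolatingCut R r C' → cutSize G C' ≤ τ → r ∈ C r ∧ k r ≤ cutSize G C' := by
    intro G hT hC hk r hr C' hC' hle
    obtain ⟨C'', hsub, hrC, hle'⟩ := exists_subset_region hT hr hC' hle
    have h1 := (hC r hr).2 C'' hsub
    simp only [penalizedCutSize, hrC, if_true, hk r hr] at h1
    -- A minimizer that misses `r` has penalized size above `τ`, so it cannot compete with `C''`.
    split_ifs at h1 with h2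
    · exact ⟨h2, by omega⟩
    · omega
  by_cases hgood : ∃ r ∈ R, r ∈ C r ∧ k r ≤ τ
  · obtain ⟨r, hr, hmin⟩ := Finset.exists_min_image {r ∈ R | r ∈ C r ∧ k r ≤ τ} k
      (by obtain ⟨r, hr⟩ := hgood; exact ⟨r, by simpa using hr⟩)
    simp only [Finset.mem_filter] at hr hmin
    refine ⟨some (C r), fun G hT hC hk => ?_⟩
    have hiso := isIsolatingCut_of_subset_region (hC r hr.1).1 hr.2.1
    have hbest : ∀ r' ∈ R, ∀ C', IsIsolatingCut R r' C' → cutSize G (C r) ≤ cutSize G C' := by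
      intro r' hr' C' hC'
      rw [hk r hr.1]
      by_cases hle : cutSize G C' ≤ τ
      · obtain ⟨h1, h2⟩ := key G hT hC hk r' hr' C' hC' hle
        exact (hmin r' ⟨hr', h1, h2.trans hle⟩).trans h2
      · omega
    exact ⟨⟨⟨r, hr.1, hiso, fun C' hC' => hbest r hr.1 C' hC'⟩,
      fun r' hr' C' hC' => hbest r' hr' C' hC'.1⟩, by rw [hk r hr.1]; exact hr.2.2⟩
  · refine ⟨none, fun G hT hC hk r hr C' hC' => ?_⟩
    by_contra hle
    obtain ⟨h1, h2⟩ := key G hT hC hk r hr C' hC' (by omega)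
    exact hgood ⟨r, hr, h1, by omega⟩

end Uncrossing

/-! ### The algorithm and its query count -/

section Algorithm

variable [Fintype V]

lemma Solves.regionCut {Out : Type u} [Nonempty Out] {P : SimpleGraph V → Prop}
    {Q : SimpleGraph V → Out → Prop} {c : ℕ} {D : ℕ} (hD : 0 < D)
    (hn : Fintype.card V ^ 2 ≤ D ^ 3) {U : Finset V} {r : V} (hr : r ∈ U) (τ : ℕ)
    (hQ : ∀ S, Solves (fun G => P G ∧ IsRegionCut U τ r G S) Q c) :
    Solves P Q (c + (minCutCost V D U.card (τ + 1) + 3 * U.card)) := by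
  rw [← add_assoc]
  have hcost : 3 * U.card = ∑ _v ∈ U, 3 := by simp [mul_comm]
  rw [hcost]
  -- Three queries per vertex reveal the sink capacities of the region.
  refine Solves.collect (A := fun v G k => edgesBetween G {v} Uᶜ = k) U
    (fun v hv P c h => Solves.queryEdges (by simpa using hv) h) P _ fun ω => ?_
  by_cases hω : ∀ v ∈ U, 0 ≤ ω v
  · refine Solves.minNetworkCut (U := U) (σ := capacity τ {r}) (ω := ω) hD hn
      (fun v _ => capacity_nonneg τ _ v) hω ((sum_capacity_le τ _ _).trans (by simp)) fun S =>
        (hQ S).mono (fun G hG => ⟨hG.1.1, hG.2.1, fun S' hS' => ?_⟩) le_rfl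
    have := hG.2.2 S' hS'
    rw [networkCut_eq_penalizedCutSize hr hG.1.2 hG.2.1,
      networkCut_eq_penalizedCutSize hr hG.1.2 hS'] at this
    exact_mod_cast this
  · refine .of_forall_not fun G hG => hω fun v hv => ?_
    rw [← hG.2 v hv]
    exact edgesBetween_nonneg G _ _

lemma minCutCost_le (D m F : ℕ) :
    minCutCost V D m F ≤ findCost V * ((D + 1) * (4 * m + F + 3)) := by
  rw [minCutCost, ← mul_add]
  exact Nat.mul_le_mul_left _ (by nlinarith)

/-- The factor `clog + 2` pays for one cut per digit, for all region cuts together (their regions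
are disjoint), and for the sink capacities and final size queries. -/
lemma solves_isIsolatingCutAnswer {D : ℕ} (hD : 0 < D) (hn : Fintype.card V ^ 2 ≤ D ^ 3)
    (hV : 0 < Fintype.card V) (R : Finset V) (τ : ℕ) :
    Solves (Out := Option (Finset V)) (fun _ => True) (fun G => IsIsolatingCutAnswer G R τ)
      ((Nat.clog 2 (Fintype.card V) + 2) *
        (findCost V * ((D + 1) * (8 * Fintype.card V + R.card * τ)))) := by
  set n := Fintype.card V with hn_def
  set L := Nat.clog 2 n with hL
  have hR : R.card ≤ n := Finset.card_le_univ R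
  have hK : 3 ≤ findCost V := by unfold findCost; omega
  have hdigits : L * minCutCost V D n (R.card * (τ + 1)) ≤
      L * (findCost V * ((D + 1) * (8 * n + R.card * τ))) := by
    refine Nat.mul_le_mul_left _ ((minCutCost_le _ _ _).trans ?_)
    refine Nat.mul_le_mul_left _ (Nat.mul_le_mul_left _ ?_)
    rw [mul_add]
    omega
  have hregions : ∀ T : ℕ → Finset V,
      ∑ r ∈ R, (minCutCost V D (region T R r).card (τ + 1) + 3 * (region T R r).card) ≤
        findCost V * ((D + 1) * (8 * n + R.card * τ)) + 3 * n := by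
    intro T
    have h1 := sum_card_region_le T R
    rw [Finset.sum_add_distrib, ← Finset.mul_sum]
    refine add_le_add ?_ (Nat.mul_le_mul_left _ h1)
    refine (Finset.sum_le_sum fun r _ => minCutCost_le _ _ _).trans ?_
    rw [← Finset.mul_sum, ← Finset.mul_sum]
    refine Nat.mul_le_mul_left _ (Nat.mul_le_mul_left _ ?_)
    simp only [Finset.sum_add_distrib, ← Finset.mul_sum, Finset.sum_const, smul_eq_mul]
    omega
  have hrest : 3 * n + R.card ≤ findCost V * ((D + 1) * (8 * n + R.card * τ)) := by
    calc 3 * n + R.card ≤ 1 * (1 * (8 * n + R.card * τ)) := by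
          have := Nat.zero_le (R.card * τ); omega
      _ ≤ _ := by gcongr <;> omega
  refine Solves.mono (P := fun _ => True) (c := 0 + R.card +
      (findCost V * ((D + 1) * (8 * n + R.card * τ)) + 3 * n) +
      ∑ _i ∈ Finset.range L, minCutCost V D n (R.card * (τ + 1))) ?_ (fun _ => id) ?_
  · refine Solves.collect (A := IsDigitCut R τ) (Finset.range L) (fun i _ P c h => ?_) _ _ fun T => ?_
    · have := Solves.minNetworkCut (P := P) (U := Finset.univ) (D := D)
        (σ := capacity τ (terminals R true i)) (ω := capacity τ (terminals R false i))
        hD hn (fun v _ => capacity_nonneg τ _ v) (fun v _ => capacity_nonneg τ _ v)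
        (F := R.card * (τ + 1)) ((sum_capacity_le τ _ _).trans ?_) h
      · exact this
      · exact_mod_cast Nat.mul_le_mul_right _ (Finset.card_le_card (Finset.filter_subset _ _))
    · refine Solves.mono ?_ (fun _ => id) (Nat.add_le_add_left (hregions T) _)
      refine Solves.collect (A := fun r G S => IsRegionCut (region T R r) τ r G S) R
        (fun r _ P c h => Solves.regionCut hD hn (Finset.mem_insert_self _ _) τ h) _ _ fun C => ?_
      rw [Finset.card_eq_sum_ones]
      refine Solves.collect (A := fun r G k => cutSize G (C r) = k) R
        (fun r _ P c h => Solves.query _ h) _ _ fun k => ?_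
      obtain ⟨ans, h⟩ := exists_isIsolatingCutAnswer (R := R) (τ := τ) T C k
      exact .output ans fun G hG => h G hG.1.1.2 hG.1.2 hG.2
  · rw [Finset.sum_const, Finset.card_range, smul_eq_mul, add_mul L]
    omega

end Algorithm

/-! ### Real-valued bounds -/

section Bound

lemma clog_two_le {n : ℕ} (hn : 0 < n) : (Nat.clog 2 n : ℝ) ≤ 1 + 2 * Real.log n := by
  rcases Nat.lt_or_ge 1 n with h | h
  · have h1 := Nat.pow_pred_clog_lt_self one_lt_two h
    have h2 : ((2 : ℝ) ^ (Nat.clog 2 n - 1)) ≤ n := by exact_mod_cast h1.le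
    have h3 := Real.log_le_log (by positivity) h2
    rw [Real.log_pow] at h3
    have h4 := Nat.clog_pos one_lt_two h
    rw [Nat.cast_sub h4] at h3
    -- Only `log 2 > 1 / 2` matters, giving the factor `2`.
    have h5 := Real.log_two_gt_d9
    have h6 : (0 : ℝ) ≤ (Nat.clog 2 n : ℝ) - (1 : ℕ) := by
      rw [sub_nonneg]; exact_mod_cast h4
    push_cast at h3 h6
    nlinarith
  · obtain rfl : n = 1 := by omega
    simp

lemma cost_le {n L D q : ℕ} {a : ℝ} {k : ℕ} (hn : 0 < n) (hL : (L : ℝ) ≤ 1 + 2 * Real.log n)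
    (hD : (D : ℝ) ≤ (n : ℝ) ^ (2 / 3 : ℝ) + 1) (hq : (q : ℝ) ≤ a * (1 + Real.log n) ^ k * n) :
    (((L + 2) * ((3 * (2 * L) + 3) * ((D + 1) * (8 * n + q))) : ℕ) : ℝ) ≤
      (108 * (8 + |a|)) * (1 + Real.log n) ^ (k + 2) * (n : ℝ) ^ (5 / 3 : ℝ) := by
  have hn1 : (1 : ℝ) ≤ n := by exact_mod_cast hn
  have hlog : 0 ≤ Real.log n := Real.log_nonneg hn1
  set x : ℝ := 1 + Real.log n with hx
  have hx1 : 1 ≤ x := by linarith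
  have hz1 : 1 ≤ (n : ℝ) ^ (2 / 3 : ℝ) := Real.one_le_rpow hn1 (by norm_num)
  have hz : (n : ℝ) ^ (5 / 3 : ℝ) = (n : ℝ) ^ (2 / 3 : ℝ) * n := by
    rw [← Real.rpow_add_one (by positivity)]; norm_num
  set z : ℝ := (n : ℝ) ^ (2 / 3 : ℝ)
  have hxk : 1 ≤ x ^ k := one_le_pow₀ hx1
  -- The factors `3`, `12` and `3` of the next three bounds multiply to `108`.
  have h1 : (L : ℝ) + 2 ≤ 3 * x := by linarith
  have h2 : 3 * (2 * (L : ℝ)) + 3 ≤ 12 * x := by linarith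
  have h3 : (D : ℝ) + 1 ≤ 3 * z := by linarith
  have h4 : 8 * (n : ℝ) + q ≤ (8 + |a|) * x ^ k * n := by
    have h5 : (n : ℝ) ≤ x ^ k * n := le_mul_of_one_le_left (by positivity) hxk
    have h6 : a * x ^ k * n ≤ |a| * x ^ k * n := by gcongr; exact le_abs_self a
    nlinarith
  push_cast
  rw [hz]
  calc ((L : ℝ) + 2) * ((3 * (2 * L) + 3) * ((D + 1) * (8 * n + q)))
      ≤ (3 * x) * ((12 * x) * ((3 * z) * ((8 + |a|) * x ^ k * n))) := by
        gcongr
    _ = (108 * (8 + |a|)) * x ^ (k + 2) * (z * n) := by ring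

end Bound

end CutQuery

theorem mainTheorem5 :
    ∃ alg : ∀ (V : Type u) [Fintype V], Finset V → ℕ → CutQueryAlg V (Option (Finset V)),
      ∀ (a : ℝ) (k : ℕ), ∃ (b : ℝ) (l : ℕ),
        ∀ (V : Type u) [Fintype V] (R : Finset V) (τ : ℕ),
          (R.card : ℝ) * (τ : ℝ) ≤
              a * (1 + Real.log (Fintype.card V)) ^ k * (Fintype.card V : ℝ) →
            ∀ G : SimpleGraph V,
              IsIsolatingCutAnswer G R τ ((alg V R τ).run G) ∧
                ((alg V R τ).queries G : ℝ) ≤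
                  b * (1 + Real.log (Fintype.card V)) ^ l *
                    (Fintype.card V : ℝ) ^ (5 / 3 : ℝ) := by
  have key : ∀ (V : Type u) [Fintype V] (R : Finset V) (τ : ℕ),
      ∃ alg : CutQueryAlg V (Option (Finset V)), ∀ G, IsIsolatingCutAnswer G R τ (alg.run G) ∧
        alg.queries G ≤ (Nat.clog 2 (Fintype.card V) + 2) * (CutQuery.findCost V *
          ((⌈(Fintype.card V : ℝ) ^ (2 / 3 : ℝ)⌉₊ + 1) *
            (8 * Fintype.card V + R.card * τ))) := by
    intro V _ R τ
    rcases Nat.eq_zero_or_pos (Fintype.card V) with h0 | hpos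
    · have := Fintype.card_eq_zero_iff.mp h0
      exact ⟨.output none, fun G => ⟨fun r _ => isEmptyElim r, Nat.zero_le _⟩⟩
    · have hpos' : (0 : ℝ) < Fintype.card V := by exact_mod_cast hpos
      obtain ⟨alg, h⟩ := CutQuery.solves_isIsolatingCutAnswer
        (D := ⌈(Fintype.card V : ℝ) ^ (2 / 3 : ℝ)⌉₊) (Nat.ceil_pos.mpr (by positivity)) (by
          -- Cubing `n ^ (2/3) ≤ D` gives the required `n ^ 2 ≤ D ^ 3`.
          have h1 := pow_le_pow_left₀ (by positivity)
            (Nat.le_ceil ((Fintype.card V : ℝ) ^ (2 / 3 : ℝ))) 3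
          rw [← Real.rpow_mul_natCast hpos'.le] at h1
          norm_num at h1
          exact_mod_cast h1) hpos R τ
      exact ⟨alg, fun G => h G trivial⟩
  choose alg halg using key
  refine ⟨alg, fun a k => ⟨108 * (8 + |a|), k + 2, fun V _ R τ hRτ G =>
    ⟨(halg V R τ G).1, ?_⟩⟩⟩
  have hq := (halg V R τ G).2
  rcases Nat.eq_zero_or_pos (Fintype.card V) with h0 | hpos
  · have := Fintype.card_eq_zero_iff.mp h0
    have hR : R = ∅ := Finset.eq_empty_of_isEmpty R
    simp only [h0, hR, Finset.card_empty, mul_zero, zero_mul, add_zero] at hq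
    have hq0 : (alg V R τ).queries G = 0 := by
      rw [hR]; omega
    rw [hq0]
    simp
  · refine (Nat.cast_le.mpr hq).trans ?_
    refine CutQuery.cost_le (D := ⌈(Fintype.card V : ℝ) ^ (2 / 3 : ℝ)⌉₊) hpos
      (CutQuery.clog_two_le hpos) (Nat.ceil_lt_add_one (by positivity)).le ?_
    push_cast
    exact hRτ
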